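/- Let $X_1, X_2, \ldots$ be independent identically distributed real random variables, $X \stackrel{d}{=} X_i$, and let $f_1, \ldots, f_m : \mathbb R \to \mathbb R$ be (Borel) functions such that $\mathbb E[f_i(X)^4] < \infty$ and $\mathrm{Var}(f_i(X)) > 0$ for every $i$, and $\mathrm{Cov}(f_i(X), f_j(X)) = 0$ for all $i \ne j$. For $f, g : \mathbb R \to \mathbb R$ and a lag $k \ge 1$ put $$\hat m(f) := \frac1N\sum_{i=1}^N f(X_i), \qquad \hat s^2(f) := \frac1N\sum_{i=1}^N \bigl(f(X_i) - \hat m(f)\bigr)^2,$$ $$\hat\gamma_k(f,g) := \frac1{N-k}\sum_{i=1}^{N-k}\bigl(f(X_i)-\hat m(f)\bigr)\bigl(g(X_{i+k})-\hat m(g)\bigr), \qquad \hat\rho_k(f,g) := \frac{\hat\gamma_k(f,g)}{\hat s(f)\,\hat s(g)},$$ and let $\hat{\mathbb C}_k := [\hat\rho_k(f_i,f_j)]_{i,j=1,\ldots,m} \in \mathbb R^{m^2}$. (On the event that $\hat s(f_i)\hat s(f_j) = 0$, and for $N \le k$, the undefined ratio $\hat\rho_k(f_i,f_j)$ is read as $0$;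 this does not affect the limit.) Fix $K$. Then the statistic $$\mathbb T_N := N\sum_{k=1}^K \|\hat{\mathbb C}_k\|^2 = N\sum_{i=1}^m\sum_{j=1}^m\sum_{k=1}^K \bigl[\hat\rho_k(f_i,f_j)\bigr]^2,$$ where $\|\cdot\|$ is the Euclidean norm, converges weakly, as $N \to \infty$, to the $\chi^2$ distribution with $m^2K$ degrees of freedom. -/

import Mathlib

open MeasureTheory ProbabilityTheory Filter

noncomputable section

namespace IIDTest

/-- The empirical mean of `f` over the first `N` observations `x 0, …, x (N - 1)`. -/
def empMean (x : ℕ → ℝ) (N : ℕ) (f : ℝ → ℝ) : ℝ :=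
  1 / (N : ℝ) * ∑ i ∈ Finset.range N, f (x i)

/-- The empirical standard deviation of `f` over the first `N` observations
(normalization `1 / N`). -/
def empSd (x : ℕ → ℝ) (N : ℕ) (f : ℝ → ℝ) : ℝ :=
  Real.sqrt (1 / (N : ℝ) * ∑ i ∈ Finset.range N, (f (x i) - empMean x N f) ^ 2)

/-- The empirical cross-covariance of `f` and `g` at lag `k`:
`(N - k)⁻¹ ∑ (f (x i) - mean f) * (g (x (i + k)) - mean g)`, the sum running over the `N - k`
pairs of observations at distance `k`. The sum is empty for `N ≤ k`. -/
def empCrossCov (x : ℕ → ℝ) (N k : ℕ) (f g : ℝ → ℝ) : ℝ :=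
  1 / ((N : ℝ) - (k : ℝ)) *
    ∑ i ∈ Finset.range (N - k), (f (x i) - empMean x N f) * (g (x (i + k)) - empMean x N g)

/-- The empirical cross-correlation of `f` and `g` at lag `k`. -/
def empCrossCorr (x : ℕ → ℝ) (N k : ℕ) (f g : ℝ → ℝ) : ℝ :=
  empCrossCov x N k f g / (empSd x N f * empSd x N g)

/-- The vector in `ℝ^(m²)`, with its Euclidean norm, of all empirical auto- and
cross-correlations of `f 0, …, f (m - 1)` at lag `k`. -/
def corrVector {m : ℕ} (f : Fin m → ℝ → ℝ) (x : ℕ → ℝ) (N k : ℕ) :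
    EuclideanSpace ℝ (Fin m × Fin m) :=
  WithLp.toLp 2 fun p => empCrossCorr x N k (f p.1) (f p.2)

/-- The generalized Box–Pierce statistic with lags `1, …, K`. -/
def boxPierce {m : ℕ} (f : Fin m → ℝ → ℝ) (K : ℕ) (x : ℕ → ℝ) (N : ℕ) : ℝ :=
  (N : ℝ) * ∑ k ∈ Finset.Icc 1 K, ‖corrVector f x N k‖ ^ 2

/-- The chi-squared distribution with `n` degrees of freedom: the law of the sum of squares of
`n` independent standard Gaussian random variables. -/
def chiSquared (n : ℕ) : Measure ℝ :=
  (Measure.pi fun _ : Fin n => gaussianReal 0 1).map fun z => ∑ i, z i ^ 2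

instance instIsProbabilityMeasureChiSquared (n : ℕ) : IsProbabilityMeasure (chiSquared n) :=
  Measure.isProbabilityMeasure_map (Measurable.aemeasurable (by fun_prop))

end IIDTest

end

/-! Empirical correlations are invariant under increasing affine maps, so each `f i` may be replaced
by its standardization `y i`; the variables `y i (X 0)` are then centered and orthonormal.
Independence makes the lagged products `y i (X t) * y j (X (t + k))` orthonormal in L², over times
and over triples (i, j, k) alike (`integral_lagProd_mul_lagProd`). Their m²K normalized sums thus
have the identity as covariance matrix, and the limit should be a standard Gaussian vector, whose
squared norm is chi-squared.

The products are only K-dependent. In the spirit of Cramér–Wold, a linear combination of them is a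
function of K + 1 consecutive observations, and `tendsto_charFun_sum_window` is a central limit
theorem for such functions. Blocks of L terms separated by gaps of K terms are i.i.d., so the
classical theorem applies to them as N → ∞; by orthogonality the omitted terms carry a share of the
variance tending to K / (L + K), which vanishes as L → ∞.

It remains to replace these sums by √N times the correlations. Empirical centering and the missing
last pairs cost O(N^(-1/2)) in L¹ (`integral_abs_centeredLagVector_sub_le`), and the remaining scale
factors tend to 1 by the strong law (`tendsto_corrScale`). Slutsky's theorem and continuous mapping
conclude. -/

namespace IIDTest

open scoped Topology

/-! ### Independent, identically distributed stretches of an i.i.d. sequence -/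

section Windows

variable {Ω : Type*} [MeasurableSpace Ω] {P : Measure Ω}

variable {E : Type*} [MeasurableSpace E] {X : ℕ → Ω → E}

/-- Grouping an independent family indexed by a product gives an independent family. -/
lemma iIndepFun_curry {ι κ : Type*} {Y : ι × κ → Ω → E} (mY : ∀ p, Measurable (Y p))
    (h : iIndepFun Y P) : iIndepFun (fun i ω k => Y (i, k) ω) P := by
  have := h.isProbabilityMeasure
  have : ∀ i k, IsProbabilityMeasure (P.map (Y (i, k))) := fun i k =>
    Measure.isProbabilityMeasure_map (mY _).aemeasurable
  rw [iIndepFun_iff_map_fun_eq_infinitePi_map (by fun_prop)]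
  have hcol : ∀ i, P.map (fun ω k => Y (i, k) ω) =
      Measure.infinitePi fun k => P.map (Y (i, k)) := fun i =>
    (h.precomp (g := fun k => (i, k)) (fun a b hab => by simpa using hab)).map_fun_eq_infinitePi_map
      (fun k => mY _)
  simp_rw [hcol]
  rw [← Measure.infinitePi_map_curry (fun i k => P.map (Y (i, k))),
    ← h.map_fun_eq_infinitePi_map mY, Measure.map_map (by fun_prop) (by fun_prop)]
  rfl

/-- The stretch `X a, …, X (a + M - 1)` of a sequence. -/
def window {Ω E : Type*} (X : ℕ → Ω → E) (M a : ℕ) (ω : Ω) : Fin M → E := fun r => X (a + r) ω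

lemma measurable_window (hX : ∀ n, Measurable (X n)) (M a : ℕ) : Measurable (window X M a) :=
  measurable_pi_lambda _ fun _ => hX _

/-- Division with remainder identifies ℕ with ℕ × `Fin M`, and the windows starting at multiples of
`M` are the rows. -/
lemma iIndepFun_window (hX : ∀ n, Measurable (X n)) (h : iIndepFun X P) (M : ℕ) [NeZero M] :
    iIndepFun (fun b => window X M (b * M)) P :=
  iIndepFun_curry (Y := fun p : ℕ × Fin M => X ((Nat.divModEquiv M).symm p)) (fun _ => hX _)
    (h.precomp (Nat.divModEquiv M).symm.injective)

lemma identDistrib_window (h : iIndepFun X P)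
    (hident : ∀ n, IdentDistrib (X n) (X 0) P P) (M a b : ℕ) :
    IdentDistrib (window X M a) (window X M b) P P :=
  IdentDistrib.pi (X := fun (r : Fin M) => X (a + r)) (Y := fun (r : Fin M) => X (b + r))
    (fun _ => (hident _).trans (hident _).symm)
    (h.precomp (g := fun r : Fin M => a + r) fun r s hrs => Fin.ext (by simpa using hrs))
    (h.precomp (g := fun r : Fin M => b + r) fun r s hrs => Fin.ext (by simpa using hrs))

end Windows

/-! ### L² estimates for characteristic functions, and iterated limits -/

section Estimates

variable {Ω : Type*} [MeasurableSpace Ω] {P : Measure Ω}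

lemma norm_exp_mul_I_sub_exp_mul_I_le (a b : ℝ) :
    ‖Complex.exp (a * Complex.I) - Complex.exp (b * Complex.I)‖ ≤ |a - b| := by
  have h : Complex.exp (a * Complex.I) - Complex.exp (b * Complex.I) =
      Complex.exp (b * Complex.I) * (Complex.exp (Complex.I * ((a - b : ℝ) : ℂ)) - 1) := by
    rw [mul_sub, ← Complex.exp_add, mul_one]
    congr 2
    push_cast
    ring
  rw [h, norm_mul, Complex.norm_exp_ofReal_mul_I, one_mul]
  exact Real.norm_exp_I_mul_ofReal_sub_one_le

lemma integral_sq_sum_of_orthogonal {Z : ℕ → Ω → ℝ} {v : ℝ} (hZ : ∀ t, MemLp (Z t) 2 P)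
    (hsq : ∀ t, ∫ ω, Z t ω ^ 2 ∂P = v) (horth : ∀ s t, s ≠ t → ∫ ω, Z s ω * Z t ω ∂P = 0)
    (S : Finset ℕ) : ∫ ω, (∑ t ∈ S, Z t ω) ^ 2 ∂P = S.card * v := by
  have hint : ∀ s t, Integrable (fun ω => Z s ω * Z t ω) P := fun s t =>
    (hZ s).integrable_mul (hZ t)
  simp_rw [sq, Finset.sum_mul_sum]
  rw [integral_finsetSum _ fun s _ => integrable_finsetSum _ fun t _ => hint s t]
  have : ∀ s ∈ S, ∫ ω, ∑ t ∈ S, Z s ω * Z t ω ∂P = v := by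
    intro s hs
    rw [integral_finsetSum _ fun t _ => hint s t, Finset.sum_eq_single_of_mem s hs
      fun t _ hts => horth s t hts.symm, ← hsq s]
    simp_rw [sq]
  rw [Finset.sum_congr rfl this]
  simp

variable [IsProbabilityMeasure P]

/-- This is the nonnegativity of the variance of |f|. -/
lemma integral_abs_le_sqrt_integral_sq {f : Ω → ℝ} (hf : MemLp f 2 P) :
    ∫ ω, |f ω| ∂P ≤ √(∫ ω, f ω ^ 2 ∂P) := by
  apply Real.le_sqrt_of_sq_le
  have h := variance_nonneg |f| P
  rw [variance_eq_sub hf.abs] at h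
  simp only [Pi.pow_apply, Pi.abs_apply, sq_abs] at h
  linarith

/-- Since x ↦ exp(iux) is |u|-Lipschitz, an L² error made uniformly small costs little in the
characteristic function; this controls the terms discarded between blocks. -/
lemma norm_charFun_map_sub_le {U V : Ω → ℝ} (hU : MemLp U 2 P) (hV : MemLp V 2 P) (u : ℝ) :
    ‖charFun (P.map U) u - charFun (P.map V) u‖ ≤ |u| * √(∫ ω, (U ω - V ω) ^ 2 ∂P) := by
  have key : ∀ {W : Ω → ℝ}, AEMeasurable W P →
      Integrable (fun ω => Complex.exp ((u * W ω : ℝ) * Complex.I)) P := by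
    intro W hW
    refine Integrable.of_bound (by fun_prop) 1 (ae_of_all _ fun ω => ?_)
    rw [Complex.norm_exp_ofReal_mul_I]
  have hmap : ∀ {W : Ω → ℝ}, AEMeasurable W P →
      charFun (P.map W) u = ∫ ω, Complex.exp ((u * W ω : ℝ) * Complex.I) ∂P := by
    intro W hW
    rw [charFun_apply_real, integral_map hW (by fun_prop)]
    simp
  rw [hmap hU.aemeasurable, hmap hV.aemeasurable,
    ← integral_sub (key hU.aemeasurable) (key hV.aemeasurable)]
  refine (norm_integral_le_integral_norm _).trans ?_
  calc ∫ ω, ‖Complex.exp ((u * U ω : ℝ) * Complex.I) - Complex.exp ((u * V ω : ℝ) * Complex.I)‖ ∂P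
      ≤ ∫ ω, |u| * |U ω - V ω| ∂P := by
        refine integral_mono ((key hU.aemeasurable).sub (key hV.aemeasurable)).norm
          (((hU.sub hV).integrable (by norm_num)).abs.const_mul _) fun ω => ?_
        refine (norm_exp_mul_I_sub_exp_mul_I_le _ _).trans ?_
        rw [← mul_sub, abs_mul]
    _ = |u| * ∫ ω, |U ω - V ω| ∂P := integral_const_mul _ _
    _ ≤ _ := by
        gcongr
        exact integral_abs_le_sqrt_integral_sq (hU.sub hV)

/-- If `a` is approximated by sequences `b L` up to `d L`, where everything converges as the
argument tends to infinity and then as `L` does, then `a` converges to the iterated limit. -/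
lemma tendsto_of_double_limit {a : ℕ → ℂ} {b : ℕ → ℕ → ℂ} {c : ℕ → ℂ} {c₀ : ℂ}
    {d : ℕ → ℕ → ℝ} {e : ℕ → ℝ} (hab : ∀ L N, ‖a N - b L N‖ ≤ d L N)
    (hb : ∀ᶠ L in atTop, Tendsto (b L) atTop (𝓝 (c L))) (hc : Tendsto c atTop (𝓝 c₀))
    (hd : ∀ᶠ L in atTop, Tendsto (d L) atTop (𝓝 (e L))) (he : Tendsto e atTop (𝓝 0)) :
    Tendsto a atTop (𝓝 c₀) := by
  rw [Metric.tendsto_nhds]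
  intro ε hε
  obtain ⟨L, hbL, hcL, hdL, heL⟩ := (hb.and ((Metric.tendsto_nhds.1 hc (ε / 4) (by positivity)).and
    (hd.and (he.eventually_lt_const (show (0 : ℝ) < ε / 4 by positivity))))).exists
  filter_upwards [Metric.tendsto_nhds.1 hbL (ε / 4) (by positivity),
    hdL.eventually_lt_const (show e L < e L + ε / 4 by linarith)] with N h1 h2
  have h3 := hab L N
  rw [← dist_eq_norm] at h3
  linarith [dist_triangle4 (a N) (b L N) (c L) c₀]

end Estimates

lemma tendsto_natDiv_div (M : ℕ) :
    Tendsto (fun N : ℕ => ((N / M : ℕ) : ℝ) / N) atTop (𝓝 (M : ℝ)⁻¹) := by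
  have h := (tendsto_nat_floor_mul_div_atTop (R := ℝ) (a := (M : ℝ)⁻¹) (by positivity)).comp
    tendsto_natCast_atTop_atTop
  refine h.congr fun N => ?_
  simp only [Function.comp_apply]
  rw [inv_mul_eq_div, Nat.floor_div_eq_div]

/-! ### Central limit theorem for K-dependent orthogonal sequences, by blocks -/

section CentralLimit

variable {Ω E : Type*} {X : ℕ → Ω → E} {K : ℕ} {g : (Fin (K + 1) → E) → ℝ}

/-- The sum of the `L` consecutive terms `g (X t, …, X (t + K))` with `b (L + K) ≤ t < b (L + K) + L`. -/
def blockSum (X : ℕ → Ω → E) (g : (Fin (K + 1) → E) → ℝ) (L b : ℕ) (ω : Ω) : ℝ :=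
  ∑ r ∈ Finset.range L, g (window X (K + 1) (b * (L + K) + r) ω)

/-- The times used by distinct blocks are distinct, because the quotient by `L + K` recovers the
block. By orthogonality, only the number of unused times will matter for the error. -/
lemma sum_blockSum_eq (L N : ℕ) :
    ∃ T ⊆ Finset.range N, T.card = N / (L + K) * L ∧
      ∀ ω, ∑ b ∈ Finset.range (N / (L + K)), blockSum X g L b ω =
        ∑ t ∈ T, g (window X (K + 1) t ω) := by
  have hinj : Set.InjOn (fun p : ℕ × ℕ => p.1 * (L + K) + p.2)
      ↑(Finset.range (N / (L + K)) ×ˢ Finset.range L) := by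
    rintro ⟨b, r⟩ hp ⟨b', r'⟩ hp' heq
    simp only [Finset.coe_product, Set.mem_prod, Finset.mem_coe, Finset.mem_range] at hp hp' heq
    have hb : b = b' := by
      have h1 : (b * (L + K) + r) / (L + K) = b := by
        rw [mul_comm, Nat.mul_add_div (by omega), Nat.div_eq_of_lt (by omega), add_zero]
      have h2 : (b' * (L + K) + r') / (L + K) = b' := by
        rw [mul_comm, Nat.mul_add_div (by omega), Nat.div_eq_of_lt (by omega), add_zero]
      rw [← h1, heq, h2]
    subst hb
    simp only [Prod.mk.injEq, true_and]
    omega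
  refine ⟨(Finset.range (N / (L + K)) ×ˢ Finset.range L).image fun p => p.1 * (L + K) + p.2,
    ?_, ?_, fun ω => ?_⟩
  · intro t ht
    obtain ⟨⟨b, r⟩, hp, rfl⟩ := Finset.mem_image.1 ht
    simp only [Finset.mem_product, Finset.mem_range] at hp ⊢
    have h1 : (b + 1) * (L + K) ≤ N / (L + K) * (L + K) := Nat.mul_le_mul_right _ hp.1
    have h2 := Nat.div_mul_le_self N (L + K)
    linarith
  · rw [Finset.card_image_of_injOn hinj]
    simp
  · rw [Finset.sum_image hinj, Finset.sum_product]
    rfl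

lemma blockSum_eq_comp_window (L b : ℕ) :
    blockSum X g L b = (fun w : Fin (L + K) → E => ∑ r : Fin L,
      g fun j : Fin (K + 1) => w ⟨r + j, by omega⟩) ∘ window X (L + K) (b * (L + K)) := by
  ext ω
  simp only [blockSum, Function.comp_apply, Finset.sum_range]
  refine Finset.sum_congr rfl fun r _ => congrArg g (funext fun j => ?_)
  simp only [window, add_assoc]

variable [MeasurableSpace Ω] {P : Measure Ω} [MeasurableSpace E]

lemma measurable_sum_window (hg : Measurable g) (L : ℕ) :
    Measurable fun w : Fin (L + K) → E => ∑ r : Fin L,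
      g fun j : Fin (K + 1) => w ⟨r + j, by omega⟩ :=
  Finset.measurable_sum _ fun _ _ => hg.comp (measurable_pi_lambda _ fun _ => measurable_pi_apply _)

lemma iIndepFun_blockSum (hX : ∀ n, Measurable (X n)) (h : iIndepFun X P) (hg : Measurable g)
    (L : ℕ) [NeZero (L + K)] : iIndepFun (blockSum X g L) P := by
  rw [funext fun b => blockSum_eq_comp_window (X := X) (g := g) L b]
  exact (iIndepFun_window hX h (L + K)).comp _ fun _ => measurable_sum_window hg L

lemma identDistrib_blockSum (h : iIndepFun X P) (hident : ∀ n, IdentDistrib (X n) (X 0) P P)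
    (hg : Measurable g) (L b : ℕ) : IdentDistrib (blockSum X g L b) (blockSum X g L 0) P P := by
  rw [blockSum_eq_comp_window, blockSum_eq_comp_window]
  exact (identDistrib_window h hident _ _ _).comp (measurable_sum_window hg L)

variable [IsProbabilityMeasure P]

/-- The classical theorem for i.i.d. blocks, read along the number n = N / (L + K) of complete
blocks. Slutsky's theorem accounts for the change of normalization √(n / N) → (L + K)^(-1/2). -/
lemma tendsto_charFun_sum_blockSum (hX : ∀ n, Measurable (X n)) (h : iIndepFun X P)
    (hident : ∀ n, IdentDistrib (X n) (X 0) P P) (hg : Measurable g) {L : ℕ} (hL : L ≠ 0) {v : ℝ}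
    (h2 : MemLp (blockSum X g L 0) 2 P) (h0 : ∫ ω, blockSum X g L 0 ω ∂P = 0)
    (hv : ∫ ω, blockSum X g L 0 ω ^ 2 ∂P = v) (u : ℝ) :
    Tendsto (fun N : ℕ => charFun (P.map fun ω =>
      (√N)⁻¹ * ∑ b ∈ Finset.range (N / (L + K)), blockSum X g L b ω) u) atTop
      (𝓝 (Complex.exp (-(v / (L + K) * u ^ 2 / 2) : ℝ))) := by
  have : NeZero (L + K) := ⟨by omega⟩
  have hvar : Var[blockSum X g L 0; P] = v := by
    rw [variance_eq_integral h2.aemeasurable, h0]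
    simpa using hv
  have hv0 : 0 ≤ v := hvar ▸ variance_nonneg _ _
  have hclt := tendstoInDistribution_inv_sqrt_mul_sum_sub
    (Y := (id : ℝ → ℝ)) (P' := gaussianReal 0 Var[blockSum X g L 0; P].toNNReal) HasLaw.id h2
    (iIndepFun_blockSum hX h hg L) (identDistrib_blockSum h hident hg L)
  have hdiv : Tendsto (fun N : ℕ => N / (L + K)) atTop atTop :=
    Nat.tendsto_div_const_atTop (by omega)
  have hclt' : TendstoInDistribution (fun (N : ℕ) ω => (√((N / (L + K) : ℕ) : ℝ))⁻¹ *
      (∑ b ∈ Finset.range (N / (L + K)), blockSum X g L b ω -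
        (N / (L + K) : ℕ) * P[blockSum X g L 0])) atTop (id : ℝ → ℝ) (fun _ => P)
      (gaussianReal 0 Var[blockSum X g L 0; P].toNNReal) :=
    ⟨fun N => hclt.forall_aemeasurable _, by fun_prop, hclt.tendsto.comp hdiv⟩
  have hscale : TendstoInMeasure P (fun (N : ℕ) (_ : Ω) => √(((N / (L + K) : ℕ) : ℝ) / N)) atTop
      fun _ => √((L + K : ℕ) : ℝ)⁻¹ :=
    tendstoInMeasure_of_tendsto_ae (fun _ => by fun_prop) (ae_of_all _ fun _ =>
      (tendsto_natDiv_div (L + K)).sqrt)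
  have hlim := hclt'.continuous_comp_prodMk_of_tendstoInMeasure_const
    (g := fun p : ℝ × ℝ => p.2 * p.1) (by fun_prop) hscale (by fun_prop)
  have hchar := ProbabilityMeasure.tendsto_iff_tendsto_charFun.1 hlim.tendsto u
  simp only [ProbabilityMeasure.coe_mk, id] at hchar
  rw [charFun_map_mul, charFun_gaussianReal, hvar] at hchar
  convert hchar using 2
  · rename_i N
    congr 2
    ext ω
    rw [h0, mul_zero, sub_zero, ← mul_assoc]
    -- The factor √n cancels only when there is a complete block; otherwise the sum is empty.
    rcases Nat.eq_zero_or_pos (N / (L + K)) with hn | hn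
    · simp [hn]
    · have : (0 : ℝ) < ((N / (L + K) : ℕ) : ℝ) := by exact_mod_cast hn
      rw [Real.sqrt_div this.le]
      congr 1
      field_simp
  · congr 1
    rw [Real.coe_toNNReal _ hv0]
    have hs : ((√((L + K : ℕ) : ℝ)⁻¹ : ℝ) : ℂ) ^ 2 = ((L + K : ℕ) : ℂ)⁻¹ := by
      rw [← Complex.ofReal_pow, Real.sq_sqrt (by positivity)]
      push_cast
      rfl
    push_cast at hs ⊢
    rw [mul_pow, hs]
    ring

/-- A central limit theorem for the sequence `g (X t, …, X (t + K))`, whose terms are centered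
and uncorrelated and depend on overlapping stretches of an i.i.d. sequence. -/
theorem tendsto_charFun_sum_window (hX : ∀ n, Measurable (X n)) (h : iIndepFun X P)
    (hident : ∀ n, IdentDistrib (X n) (X 0) P P) (hg : Measurable g)
    (h2 : MemLp (fun ω => g (window X (K + 1) 0 ω)) 2 P)
    (h0 : ∫ ω, g (window X (K + 1) 0 ω) ∂P = 0)
    (horth : ∀ s t, s ≠ t → ∫ ω, g (window X (K + 1) s ω) * g (window X (K + 1) t ω) ∂P = 0)
    {v : ℝ} (hv : ∫ ω, g (window X (K + 1) 0 ω) ^ 2 ∂P = v) (u : ℝ) :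
    Tendsto (fun N : ℕ => charFun (P.map fun ω =>
      (√N)⁻¹ * ∑ t ∈ Finset.range N, g (window X (K + 1) t ω)) u) atTop
      (𝓝 (Complex.exp (-(v * u ^ 2 / 2) : ℝ))) := by
  have hid : ∀ t, IdentDistrib (fun ω => g (window X (K + 1) t ω))
      (fun ω => g (window X (K + 1) 0 ω)) P P := fun t =>
    (identDistrib_window h hident (K + 1) t 0).comp hg
  have hZ2 : ∀ t, MemLp (fun ω => g (window X (K + 1) t ω)) 2 P := fun t => (hid t).memLp_iff.2 h2
  have hZ0 : ∀ t, ∫ ω, g (window X (K + 1) t ω) ∂P = 0 := fun t => (hid t).integral_eq.trans h0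
  have hZv : ∀ t, ∫ ω, g (window X (K + 1) t ω) ^ 2 ∂P = v := fun t =>
    ((hid t).comp (measurable_id.pow_const 2)).integral_eq.trans hv
  have hsum2 : ∀ S : Finset ℕ, MemLp (fun ω => ∑ t ∈ S, g (window X (K + 1) t ω)) 2 P :=
    fun S => memLp_finsetSum _ fun t _ => hZ2 t
  have hsq : ∀ S : Finset ℕ, ∫ ω, (∑ t ∈ S, g (window X (K + 1) t ω)) ^ 2 ∂P = S.card * v :=
    fun S => integral_sq_sum_of_orthogonal (Z := fun t ω => g (window X (K + 1) t ω)) hZ2 hZv horth S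
  have hb0 : ∀ L, blockSum X g L 0 = fun ω => ∑ t ∈ Finset.range L, g (window X (K + 1) t ω) := by
    intro L
    ext ω
    simp [blockSum]
  -- `d` is the L² bound from the N - nL omitted orthogonal terms, where n = N / (L + K), and `e` is
  -- its limit in N. For `L = 0` the sequence itself serves as `b`: the comparison is then trivial,
  -- and convergence is needed only for large `L`.
  refine tendsto_of_double_limit
    (b := fun L N => if L = 0 then charFun (P.map fun ω =>
        (√N)⁻¹ * ∑ t ∈ Finset.range N, g (window X (K + 1) t ω)) u else charFun (P.map fun ω =>
      (√N)⁻¹ * ∑ b ∈ Finset.range (N / (L + K)), blockSum X g L b ω) u)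
    (c := fun L => Complex.exp (-(L * v / (L + K) * u ^ 2 / 2) : ℝ))
    (d := fun L N => |u| * √((1 - ((N / (L + K) : ℕ) : ℝ) / N * L) * v))
    (e := fun L => |u| * √((1 - ((L + K : ℕ) : ℝ)⁻¹ * L) * v)) (fun L N => ?_) ?_ ?_ ?_ ?_
  · rcases eq_or_ne L 0 with hL | hL
    · simp only [hL, if_true, sub_self, norm_zero]
      positivity
    rw [if_neg hL]
    rcases Nat.eq_zero_or_pos N with hN | hN
    · simp only [hN, Nat.cast_zero, Real.sqrt_zero, inv_zero, zero_mul, sub_self, norm_zero]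
      positivity
    obtain ⟨T, hTN, hTcard, hT⟩ := sum_blockSum_eq (X := X) (g := g) L N
    simp_rw [hT]
    refine (norm_charFun_map_sub_le ((hsum2 _).const_mul _) ((hsum2 _).const_mul _) u).trans_eq ?_
    congr 2
    have : ∀ ω, ((√N)⁻¹ * ∑ t ∈ Finset.range N, g (window X (K + 1) t ω) -
        (√N)⁻¹ * ∑ t ∈ T, g (window X (K + 1) t ω)) ^ 2 =
        (N : ℝ)⁻¹ * (∑ t ∈ Finset.range N \ T, g (window X (K + 1) t ω)) ^ 2 := by
      intro ω
      rw [← Finset.sum_sdiff hTN, ← mul_sub, add_sub_cancel_right, mul_pow, inv_pow,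
        Real.sq_sqrt (by positivity)]
    simp_rw [this]
    rw [integral_const_mul, hsq, Finset.card_sdiff_of_subset hTN, Finset.card_range,
      Nat.cast_sub (by simpa using Finset.card_le_card hTN), hTcard]
    have : (N : ℝ) ≠ 0 := by positivity
    push_cast
    field_simp
  · filter_upwards [eventually_ne_atTop 0] with L hL
    simp only [hL, if_false]
    refine tendsto_charFun_sum_blockSum hX h hident hg hL ?_ ?_ ?_ u
    · rw [hb0]
      exact hsum2 _
    · simp_rw [hb0]
      rw [integral_finsetSum _ fun t _ => (hZ2 t).integrable (by norm_num)]
      simp [hZ0]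
    · simp_rw [hb0]
      rw [hsq, Finset.card_range]
  · have : Tendsto (fun L : ℕ => (L : ℝ) / (L + K)) atTop (𝓝 1) :=
      tendsto_natCast_div_add_atTop (K : ℝ)
    have h3 : Tendsto (fun L : ℕ => -((L : ℝ) / (L + K) * v * u ^ 2 / 2)) atTop
        (𝓝 (-(1 * v * u ^ 2 / 2))) := (((this.mul_const v).mul_const _).div_const _).neg
    have h4 := ((Complex.continuous_exp.comp Complex.continuous_ofReal).tendsto _).comp h3
    rw [one_mul] at h4
    refine h4.congr fun L => ?_
    simp only [Function.comp_apply]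
    congr 2
    ring
  · filter_upwards with L
    exact ((((tendsto_natDiv_div (L + K)).mul_const _).const_sub _).mul_const _).sqrt.const_mul _
  · have : Tendsto (fun L : ℕ => (L : ℝ) / (L + K)) atTop (𝓝 1) :=
      tendsto_natCast_div_add_atTop (K : ℝ)
    have h3 := (((this.const_sub 1).mul_const v).sqrt).const_mul |u|
    simp only [sub_self, zero_mul, Real.sqrt_zero, mul_zero] at h3
    refine h3.congr fun L => ?_
    push_cast
    rw [div_eq_inv_mul]

end CentralLimit

/-- The product `y i (x t) * y j (x (t + k + 1))`, where `p = (i, j, k)`. -/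
def lagProd {m K : ℕ} (y : Fin m → ℝ → ℝ) (p : Fin m × Fin m × Fin K) (x : ℕ → ℝ) (t : ℕ) : ℝ :=
  y p.1 (x t) * y p.2.1 (x (t + (p.2.2 + 1)))

/-! ### Orthonormality and joint normality of the lagged products -/

section LaggedProducts

variable {Ω : Type*} [MeasurableSpace Ω] {P : Measure Ω} {X : ℕ → Ω → ℝ}

/-- The indices `a`, `b`, `c` may coincide, so one statement covers every overlap pattern of two
lagged products. -/
lemma indepFun_of_ne_three (hX : ∀ n, Measurable (X n)) (h : iIndepFun X P) {a b c e : ℕ}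
    (ha : a ≠ e) (hb : b ≠ e) (hc : c ≠ e) :
    IndepFun (fun ω => (X a ω, X b ω, X c ω)) (X e) P := by
  have hdisj : Disjoint ({a, b, c} : Finset ℕ) {e} := by
    simp [ha.symm, hb.symm, hc.symm]
  exact (h.indepFun_finset {a, b, c} {e} hdisj hX).comp
    (φ := fun w : ({a, b, c} : Finset ℕ) → ℝ =>
      (w ⟨a, by simp⟩, w ⟨b, by simp⟩, w ⟨c, by simp⟩))
    (ψ := fun w : ({e} : Finset ℕ) → ℝ => w ⟨e, by simp⟩) (by fun_prop) (by fun_prop)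

lemma integral_mul_of_ne_three (hX : ∀ n, Measurable (X n)) (h : iIndepFun X P) {a b c e : ℕ}
    (ha : a ≠ e) (hb : b ≠ e) (hc : c ≠ e) {φ : ℝ × ℝ × ℝ → ℝ} (hφ : Measurable φ) {ψ : ℝ → ℝ}
    (hψ : Measurable ψ) : ∫ ω, φ (X a ω, X b ω, X c ω) * ψ (X e ω) ∂P =
      (∫ ω, φ (X a ω, X b ω, X c ω) ∂P) * ∫ ω, ψ (X e ω) ∂P :=
  ((indepFun_of_ne_three hX h ha hb hc).comp hφ hψ).integral_fun_mul_eq_mul_integral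
    (hφ.comp (by fun_prop)).aestronglyMeasurable (hψ.comp (hX e)).aestronglyMeasurable

variable {m K : ℕ} {y : Fin m → ℝ → ℝ}

/-- Compare the later times of the two products. If they differ, the latest observation occurs in a
single factor, which is centered and independent of the rest. If they agree, the two factors there
integrate to δ(j, j'), and the earlier ones give 0 when s ≠ t and δ(i, i') when s = t; in the latter
case the lags agree too. -/
lemma integral_lagProd_mul_lagProd (hX : ∀ n, Measurable (X n)) (h : iIndepFun X P)
    (hident : ∀ n, IdentDistrib (X n) (X 0) P P) (hy : ∀ i, Measurable (y i))
    (h0 : ∀ i, ∫ ω, y i (X 0 ω) ∂P = 0)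
    (horth : ∀ i j, ∫ ω, y i (X 0 ω) * y j (X 0 ω) ∂P = if i = j then 1 else 0)
    (p q : Fin m × Fin m × Fin K) (s t : ℕ) :
    ∫ ω, lagProd y p (fun n => X n ω) s * lagProd y q (fun n => X n ω) t ∂P =
      if s = t ∧ p = q then 1 else 0 := by
  have h0' : ∀ i n, ∫ ω, y i (X n ω) ∂P = 0 := fun i n =>
    ((hident n).comp (hy i)).integral_eq.trans (h0 i)
  have horth' : ∀ i j n, ∫ ω, y i (X n ω) * y j (X n ω) ∂P = if i = j then 1 else 0 := fun i j n =>
    ((hident n).comp ((hy i).mul (hy j))).integral_eq.trans (horth i j)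
  obtain ⟨i, j, k⟩ := p
  obtain ⟨i', j', l⟩ := q
  simp only [lagProd, Prod.mk.injEq]
  rcases lt_trichotomy (s + (k + 1 : ℕ)) (t + (l + 1)) with hlt | heq | hgt
  · rw [if_neg (by rintro ⟨rfl, -, -, rfl⟩; exact lt_irrefl _ hlt)]
    have := integral_mul_of_ne_three (φ := fun w => y i w.1 * y j w.2.1 * y i' w.2.2)
      (ψ := y j') (a := s) (b := s + (k + 1)) (c := t) (e := t + (l + 1)) hX h (by omega) (by omega)
      (by omega) (by fun_prop) (hy j')
    rw [h0', mul_zero] at this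
    rw [← this]
    congr with ω
    ring
  · rw [← heq]
    have h1 := integral_mul_of_ne_three (φ := fun w => y i w.1 * y i' w.2.1)
      (ψ := fun z => y j z * y j' z) (a := s) (b := t) (c := t) (e := s + (k + 1)) hX h (by omega)
      (by omega) (by omega) (by fun_prop) (by fun_prop)
    rw [horth'] at h1
    have h2 : ∫ ω, y i (X s ω) * y j (X (s + (k + 1)) ω) *
        (y i' (X t ω) * y j' (X (s + (k + 1)) ω)) ∂P =
        (∫ ω, y i (X s ω) * y i' (X t ω) ∂P) * if j = j' then 1 else 0 := by
      rw [← h1]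
      congr with ω
      ring
    rw [h2]
    rcases eq_or_ne s t with rfl | hst
    · rw [horth']
      have : k = l := Fin.ext (by omega)
      by_cases hi : i = i' <;> by_cases hj : j = j' <;> simp [hi, hj, this]
    · have h3 := ((h.indepFun hst).comp (hy i) (hy i')).integral_fun_mul_eq_mul_integral
        ((hy i).comp (hX s)).aestronglyMeasurable ((hy i').comp (hX t)).aestronglyMeasurable
      simp only [Function.comp_def, h0', zero_mul] at h3
      simp [h3, hst]
  · rw [if_neg (by rintro ⟨rfl, -, -, rfl⟩; exact lt_irrefl _ hgt)]
    have := integral_mul_of_ne_three (φ := fun w => y i w.1 * y i' w.2.1 * y j' w.2.2)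
      (ψ := y j) (a := s) (b := t) (c := t + (l + 1)) (e := s + (k + 1)) hX h (by omega) (by omega)
      (by omega) (by fun_prop) (hy j)
    rw [h0', mul_zero] at this
    rw [← this]
    congr with ω
    ring

/-- The squares of the two factors are independent and integrable, so second moments of the `y i`
suffice. -/
lemma memLp_lagProd (hX : ∀ n, Measurable (X n)) (h : iIndepFun X P)
    (hident : ∀ n, IdentDistrib (X n) (X 0) P P) (hy : ∀ i, Measurable (y i))
    (h2 : ∀ i, MemLp (fun ω => y i (X 0 ω)) 2 P) (p : Fin m × Fin m × Fin K) (t : ℕ) :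
    MemLp (fun ω => lagProd y p (fun n => X n ω) t) 2 P := by
  have hsq : ∀ i n, Integrable (fun ω => y i (X n ω) ^ 2) P := fun i n =>
    (((hident n).comp (hy i)).memLp_iff.2 (h2 i)).integrable_sq
  have hmeas : Measurable fun ω => lagProd y p (fun n => X n ω) t :=
    ((hy _).comp (hX _)).mul ((hy _).comp (hX _))
  rw [memLp_two_iff_integrable_sq hmeas.aestronglyMeasurable]
  have := ((h.indepFun (show t ≠ t + (p.2.2 + 1) by omega)).comp ((hy p.1).pow_const 2)
    ((hy p.2.1).pow_const 2)).integrable_mul (hsq _ _) (hsq _ _)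
  refine this.congr (ae_of_all _ fun ω => ?_)
  simp [lagProd, mul_pow]

lemma integral_lagProd (hX : ∀ n, Measurable (X n)) (h : iIndepFun X P)
    (hident : ∀ n, IdentDistrib (X n) (X 0) P P) (hy : ∀ i, Measurable (y i))
    (h0 : ∀ i, ∫ ω, y i (X 0 ω) ∂P = 0) (p : Fin m × Fin m × Fin K) (t : ℕ) :
    ∫ ω, lagProd y p (fun n => X n ω) t ∂P = 0 := by
  have := ((h.indepFun (show t ≠ t + (p.2.2 + 1) by omega)).comp (hy p.1)
    (hy p.2.1)).integral_fun_mul_eq_mul_integral ((hy _).comp (hX _)).aestronglyMeasurable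
      ((hy _).comp (hX _)).aestronglyMeasurable
  have h1 : ∫ ω, y p.1 (X t ω) ∂P = 0 := ((hident t).comp (hy p.1)).integral_eq.trans (h0 p.1)
  simp only [Function.comp_def, h1, zero_mul] at this
  exact this

/-- The normalized sums of the lagged products, as a random vector. -/
noncomputable def lagVector (y : Fin m → ℝ → ℝ) (K : ℕ) (x : ℕ → ℝ) (N : ℕ) :
    EuclideanSpace ℝ (Fin m × Fin m × Fin K) :=
  WithLp.toLp 2 fun p => (√N)⁻¹ * ∑ t ∈ Finset.range N, lagProd y p x t

variable [IsProbabilityMeasure P]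

/-- The normalized sums of the lagged products of standardized uncorrelated functions of an i.i.d.
sequence converge to a standard Gaussian vector. -/
theorem tendstoInDistribution_lagVector (hX : ∀ n, Measurable (X n)) (h : iIndepFun X P)
    (hident : ∀ n, IdentDistrib (X n) (X 0) P P) (hy : ∀ i, Measurable (y i))
    (h2 : ∀ i, MemLp (fun ω => y i (X 0 ω)) 2 P) (h0 : ∀ i, ∫ ω, y i (X 0 ω) ∂P = 0)
    (horth : ∀ i j, ∫ ω, y i (X 0 ω) * y j (X 0 ω) ∂P = if i = j then 1 else 0) :
    TendstoInDistribution (fun (N : ℕ) ω => lagVector y K (fun n => X n ω) N) atTop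
      (id : EuclideanSpace ℝ (Fin m × Fin m × Fin K) → _) (fun _ => P) (stdGaussian _) := by
  have hmeas : ∀ p t, Measurable fun ω => lagProd (K := K) y p (fun n => X n ω) t := fun p t =>
    ((hy _).comp (hX _)).mul ((hy _).comp (hX _))
  have hmeasW : ∀ N : ℕ, Measurable fun ω => lagVector y K (fun n => X n ω) N := fun N => by
    unfold lagVector
    fun_prop
  refine ⟨fun N => (hmeasW N).aemeasurable, by fun_prop, ?_⟩
  refine ProbabilityMeasure.tendsto_iff_tendsto_charFun.2 fun u => ?_
  -- The inner product of `u` with the vector of lagged products at time t depends only on X t, …, X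
  -- (t + K).
  let g : (Fin (K + 1) → ℝ) → ℝ := fun w =>
    ∑ p : Fin m × Fin m × Fin K, u p * (y p.1 (w 0) * y p.2.1 (w p.2.2.succ))
  have hg : Measurable g := by fun_prop
  have hgw : ∀ t ω, g (window X (K + 1) t ω) = ∑ p, u p * lagProd y p (fun n => X n ω) t := by
    intro t ω
    simp [g, window, lagProd]
  have hL2 := memLp_lagProd (K := K) hX h hident hy h2
  have hprod : ∀ s t, ∫ ω, g (window X (K + 1) s ω) * g (window X (K + 1) t ω) ∂P =
      if s = t then ‖u‖ ^ 2 else 0 := by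
    intro s t
    have hint : ∀ p q, Integrable (fun ω => u p * lagProd y p (fun n => X n ω) s *
        (u q * lagProd y q (fun n => X n ω) t)) P := fun p q =>
      ((hL2 p s).const_mul _).integrable_mul ((hL2 q t).const_mul _)
    simp_rw [hgw, Finset.sum_mul_sum]
    rw [integral_finsetSum _ fun p _ => integrable_finsetSum _ fun q _ => hint p q]
    simp_rw [integral_finsetSum _ fun q _ => hint _ q, mul_mul_mul_comm, integral_const_mul,
      integral_lagProd_mul_lagProd hX h hident hy h0 horth]
    rw [EuclideanSpace.real_norm_sq_eq]
    rcases eq_or_ne s t with rfl | hst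
    · simp [sq]
    · simp [hst]
  -- The frequency `u` is already absorbed in `g`, so the scalar characteristic function is taken at
  -- 1.
  have hclt := tendsto_charFun_sum_window (v := ‖u‖ ^ 2) hX h hident hg ?_ ?_
    (fun s t hst => by rw [hprod, if_neg hst]) ?_ 1
  · simp only [ProbabilityMeasure.coe_mk, Measure.map_id, charFun_stdGaussian]
    convert hclt using 2
    · rename_i N
      have hgsum : Measurable fun ω =>
          (√N)⁻¹ * ∑ t ∈ Finset.range N, g (window X (K + 1) t ω) :=
        (Finset.measurable_sum _ fun t _ => hg.comp (measurable_window hX _ _)).const_mul _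
      rw [charFun_apply, charFun_apply, integral_map (hmeasW N).aemeasurable (by fun_prop),
        integral_map hgsum.aemeasurable (by fun_prop)]
      congr with ω
      congr 3
      simp_rw [hgw]
      rw [Finset.sum_comm, PiLp.inner_apply]
      simp only [lagVector, RCLike.inner_apply, conj_trivial, one_mul, Finset.mul_sum]
      refine Finset.sum_congr rfl fun p _ => Finset.sum_congr rfl fun t _ => ?_
      ring
    · congr 1
      push_cast
      ring
  · simp_rw [hgw]
    exact memLp_finsetSum _ fun p _ => (hL2 p 0).const_mul _
  · simp_rw [hgw]
    rw [integral_finsetSum _ fun p _ => ((hL2 p 0).const_mul _).integrable (by norm_num)]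
    simp_rw [integral_const_mul, integral_lagProd hX h hident hy h0]
    simp
  · simp_rw [sq (g _)]
    rw [hprod, if_pos rfl]

end LaggedProducts

/-! ### Algebra of the statistic and a pathwise bound for centering -/

section Deterministic

lemma empMean_sub_div (x : ℕ → ℝ) {N : ℕ} (hN : N ≠ 0) (f : ℝ → ℝ) (μ σ : ℝ) :
    empMean x N (fun z => (f z - μ) / σ) = (empMean x N f - μ) / σ := by
  have : (N : ℝ) ≠ 0 := by positivity
  simp only [empMean, ← Finset.sum_div, Finset.sum_sub_distrib, Finset.sum_const,
    Finset.card_range, nsmul_eq_mul]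
  field_simp

lemma sub_empMean_sub_div (x : ℕ → ℝ) {N : ℕ} (hN : N ≠ 0) (f : ℝ → ℝ) (μ σ z : ℝ) :
    (f z - μ) / σ - empMean x N (fun z => (f z - μ) / σ) = (f z - empMean x N f) / σ := by
  rw [empMean_sub_div x hN]
  ring

lemma empSd_sub_div (x : ℕ → ℝ) {N : ℕ} (hN : N ≠ 0) (f : ℝ → ℝ) (μ : ℝ) {σ : ℝ} (hσ : 0 < σ) :
    empSd x N (fun z => (f z - μ) / σ) = empSd x N f / σ := by
  unfold empSd
  simp_rw [sub_empMean_sub_div x hN, div_pow]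
  rw [← Finset.sum_div, mul_div_assoc', Real.sqrt_div' _ (by positivity), Real.sqrt_sq hσ.le]

/-- The empirical cross-correlation is invariant under increasing affine transformations. -/
lemma empCrossCorr_sub_div (x : ℕ → ℝ) (N k : ℕ) (f g : ℝ → ℝ) (μ ν : ℝ) {σ τ : ℝ} (hσ : 0 < σ)
    (hτ : 0 < τ) : empCrossCorr x N k (fun z => (f z - μ) / σ) (fun z => (g z - ν) / τ) =
      empCrossCorr x N k f g := by
  rcases eq_or_ne N 0 with rfl | hN
  · simp [empCrossCorr, empCrossCov]
  unfold empCrossCorr empCrossCov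
  simp_rw [sub_empMean_sub_div x hN, empSd_sub_div x hN _ _ hσ, empSd_sub_div x hN _ _ hτ,
    div_mul_div_comm]
  rw [← Finset.sum_div, mul_div_assoc', div_div_div_cancel_right₀ (by positivity)]

lemma sum_Icc_one_eq_sum_fin (F : ℕ → ℝ) (K : ℕ) :
    ∑ k ∈ Finset.Icc 1 K, F k = ∑ k : Fin K, F (k + 1) := by
  rw [← Finset.sum_range fun k => F (k + 1)]
  induction K with
  | zero => simp
  | succ K ih => rw [Finset.sum_Icc_succ_top (by omega), ih, Finset.sum_range_succ]

lemma boxPierce_eq_sum {m : ℕ} (f : Fin m → ℝ → ℝ) (K : ℕ) (x : ℕ → ℝ) (N : ℕ) :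
    boxPierce f K x N = (N : ℝ) * ∑ i : Fin m, ∑ j : Fin m, ∑ k ∈ Finset.Icc 1 K,
      empCrossCorr x N k (f i) (f j) ^ 2 := by
  unfold boxPierce
  simp_rw [EuclideanSpace.real_norm_sq_eq, corrVector]
  congr 1
  rw [Finset.sum_comm, Fintype.sum_prod_type]

variable {m K : ℕ}

/-- The analogue of `lagVector` with empirically centered factors, the sums running over the
available pairs of observations only. -/
noncomputable def centeredLagVector (y : Fin m → ℝ → ℝ) (K : ℕ) (x : ℕ → ℝ) (N : ℕ) :
    EuclideanSpace ℝ (Fin m × Fin m × Fin K) :=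
  WithLp.toLp 2 fun p => (√N)⁻¹ * ∑ t ∈ Finset.range (N - (p.2.2 + 1)),
    (y p.1 (x t) - empMean x N (y p.1)) * (y p.2.1 (x (t + (p.2.2 + 1))) - empMean x N (y p.2.1))

/-- The factor by which `√N` times an empirical cross-correlation differs from the component of
`centeredLagVector`. -/
noncomputable def corrScale (y : Fin m → ℝ → ℝ) (K : ℕ) (x : ℕ → ℝ) (N : ℕ) :
    Fin m × Fin m × Fin K → ℝ :=
  fun p => N / (N - (p.2.2 + 1 : ℕ)) / (empSd x N (y p.1) * empSd x N (y p.2.1))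

/-- No restriction on `N` or on the standard deviations is needed: both sides use the same
conventions for division by zero and the same empty sums. -/
lemma sqrt_mul_empCrossCorr (y : Fin m → ℝ → ℝ) (x : ℕ → ℝ) (N : ℕ) (p : Fin m × Fin m × Fin K) :
    √N * empCrossCorr x N (p.2.2 + 1) (y p.1) (y p.2.1) =
      centeredLagVector y K x N p * corrScale y K x N p := by
  rcases eq_or_ne N 0 with rfl | hN
  · simp [corrScale]
  have hs : √(N : ℝ) ≠ 0 := by positivity
  have hs2 : √(N : ℝ) = (√N)⁻¹ * N := by
    rw [inv_mul_eq_div, Real.div_sqrt]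
  simp only [empCrossCorr, empCrossCov, centeredLagVector, corrScale]
  nth_rw 1 [hs2]
  ring

lemma boxPierce_eq_sum_sq (y : Fin m → ℝ → ℝ) (x : ℕ → ℝ) (N : ℕ) :
    boxPierce y K x N =
      ∑ p, (centeredLagVector y K x N p * corrScale y K x N p) ^ 2 := by
  simp_rw [boxPierce_eq_sum, ← sqrt_mul_empCrossCorr, sum_Icc_one_eq_sum_fin,
    Fintype.sum_prod_type, mul_pow, Real.sq_sqrt (Nat.cast_nonneg N), Finset.mul_sum]

/-- Expanding, the difference is minus the tail of `c` minus (BS + AT - (n/N)AB)/N, with S and T the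
sums of `a` and `b` over the first n indices. Bounding products by squares leaves quantities whose
expectations follow from orthogonality when `A` and `B` are the full sums. -/
lemma abs_sum_sub_mul_sub_sub_sum_le {n N : ℕ} (hn : n ≤ N) (hN : N ≠ 0) (a b c : ℕ → ℝ)
    (hc : ∀ t, c t = a t * b t) (A B : ℝ) :
    |∑ t ∈ Finset.range n, (a t - 1 / (N : ℝ) * A) * (b t - 1 / (N : ℝ) * B) -
        ∑ t ∈ Finset.range N, c t| ≤
      1 / 2 * ∑ t ∈ Finset.range N \ Finset.range n, (c t ^ 2 + 1) +
        1 / N * (A ^ 2 + B ^ 2 + 1 / 2 * (∑ t ∈ Finset.range n, a t) ^ 2 +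
          1 / 2 * (∑ t ∈ Finset.range n, b t) ^ 2) := by
  set S := ∑ t ∈ Finset.range n, a t with hS
  set T := ∑ t ∈ Finset.range n, b t with hT
  have hN0 : (0 : ℝ) < N := by positivity
  have hexp : ∑ t ∈ Finset.range n, (a t - 1 / (N : ℝ) * A) * (b t - 1 / (N : ℝ) * B) =
      ∑ t ∈ Finset.range n, c t - 1 / N * (B * S) - 1 / N * (A * T) +
        1 / N * (n / N * (A * B)) := by
    have : ∀ t, (a t - 1 / (N : ℝ) * A) * (b t - 1 / (N : ℝ) * B) =
        c t - 1 / N * B * a t - 1 / N * A * b t + 1 / N * A * (1 / N * B) := by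
      intro t
      rw [hc]
      ring
    simp_rw [this, Finset.sum_add_distrib, Finset.sum_sub_distrib, ← Finset.mul_sum,
      Finset.sum_const, Finset.card_range, nsmul_eq_mul, ← hS, ← hT]
    ring
  have hsub : Finset.range n ⊆ Finset.range N := Finset.range_subset_range.2 hn
  rw [hexp, ← Finset.sum_sdiff hsub]
  have htail : |∑ t ∈ Finset.range N \ Finset.range n, c t| ≤
      1 / 2 * ∑ t ∈ Finset.range N \ Finset.range n, (c t ^ 2 + 1) := by
    rw [Finset.mul_sum]
    refine (Finset.abs_sum_le_sum_abs _ _).trans (Finset.sum_le_sum fun t _ => ?_)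
    nlinarith [sq_nonneg (|c t| - 1), sq_abs (c t)]
  have hr : (n : ℝ) / N ≤ 1 := (div_le_one hN0).2 (by exact_mod_cast hn)
  have hr0 : (0 : ℝ) ≤ n / N := by positivity
  have hAB : |n / N * (A * B)| ≤ 1 / 2 * (A ^ 2 + B ^ 2) := by
    rw [abs_mul, abs_of_nonneg hr0]
    have : |A * B| ≤ 1 / 2 * (A ^ 2 + B ^ 2) := by
      rw [abs_le]
      constructor <;> nlinarith [sq_nonneg (A - B), sq_nonneg (A + B)]
    nlinarith [abs_nonneg (A * B)]
  have hmain : |B * S + A * T - n / N * (A * B)| ≤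
      A ^ 2 + B ^ 2 + 1 / 2 * S ^ 2 + 1 / 2 * T ^ 2 := by
    rw [abs_le] at hAB ⊢
    constructor <;> nlinarith [sq_nonneg (B - S), sq_nonneg (B + S), sq_nonneg (A - T),
      sq_nonneg (A + T)]
  have : ∑ t ∈ Finset.range n, c t - 1 / N * (B * S) - 1 / N * (A * T) +
        1 / N * (n / N * (A * B)) - (∑ t ∈ Finset.range N \ Finset.range n, c t +
          ∑ t ∈ Finset.range n, c t) = -(∑ t ∈ Finset.range N \ Finset.range n, c t) -
        1 / N * (B * S + A * T - n / N * (A * B)) := by ring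
  rw [this]
  refine (abs_sub _ _).trans (add_le_add ?_ ?_)
  · rwa [abs_neg]
  · rw [abs_mul, abs_of_nonneg (by positivity : (0 : ℝ) ≤ 1 / N)]
    gcongr

end Deterministic

/-! ### Probabilistic control of centering, truncation and scaling -/

section Remainders

variable {Ω : Type*} [MeasurableSpace Ω] {P : Measure Ω} {X : ℕ → Ω → ℝ} {m K : ℕ}
  {y : Fin m → ℝ → ℝ}

lemma measurable_empMean (hX : ∀ n, Measurable (X n)) {f : ℝ → ℝ} (hf : Measurable f) (N : ℕ) :
    Measurable fun ω => empMean (fun n => X n ω) N f := by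
  unfold empMean
  fun_prop

lemma measurable_empSd (hX : ∀ n, Measurable (X n)) {f : ℝ → ℝ} (hf : Measurable f) (N : ℕ) :
    Measurable fun ω => empSd (fun n => X n ω) N f := by
  have := measurable_empMean hX hf N
  unfold empSd
  fun_prop

lemma measurable_lagVector (hX : ∀ n, Measurable (X n)) (hy : ∀ i, Measurable (y i)) (N : ℕ) :
    Measurable fun ω => lagVector y K (fun n => X n ω) N := by
  unfold lagVector lagProd
  fun_prop

lemma measurable_centeredLagVector (hX : ∀ n, Measurable (X n)) (hy : ∀ i, Measurable (y i))
    (N : ℕ) : Measurable fun ω => centeredLagVector y K (fun n => X n ω) N := by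
  have := fun i => measurable_empMean hX (hy i) N
  unfold centeredLagVector
  fun_prop

lemma measurable_corrScale (hX : ∀ n, Measurable (X n)) (hy : ∀ i, Measurable (y i))
    (N : ℕ) : Measurable fun ω => corrScale y K (fun n => X n ω) N := by
  have := fun i => measurable_empSd hX (hy i) N
  unfold corrScale
  fun_prop

lemma tendsto_empSd (h : iIndepFun X P) (hident : ∀ n, IdentDistrib (X n) (X 0) P P) {f : ℝ → ℝ}
    (hf : Measurable f) (h1 : Integrable (fun ω => f (X 0 ω)) P)
    (h2 : Integrable (fun ω => f (X 0 ω) ^ 2) P) (h0 : ∫ ω, f (X 0 ω) ∂P = 0) :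
    ∀ᵐ ω ∂P, Tendsto (fun N => empSd (fun n => X n ω) N f) atTop
      (𝓝 √(∫ ω, f (X 0 ω) ^ 2 ∂P)) := by
  have hlln1 := strong_law_ae_real (fun n ω => f (X n ω)) h1
    (fun i j hij => (h.indepFun hij).comp hf hf) fun i => (hident i).comp hf
  have hlln2 := strong_law_ae_real (fun n ω => f (X n ω) ^ 2) h2
    (fun i j hij => (h.indepFun hij).comp (hf.pow_const 2) (hf.pow_const 2))
    fun i => (hident i).comp (hf.pow_const 2)
  filter_upwards [hlln1, hlln2] with ω hω1 hω2
  rw [h0] at hω1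
  -- The empirical variance is the mean of the squares minus the square of the mean.
  have hlim := (hω2.sub (hω1.pow 2)).sqrt
  rw [zero_pow two_ne_zero, sub_zero] at hlim
  refine hlim.congr' ?_
  filter_upwards [eventually_ne_atTop 0] with N hN
  have hN0 : (N : ℝ) ≠ 0 := by positivity
  unfold empSd
  congr 1
  have hsq : ∀ c z : ℝ, (f z - c) ^ 2 = f z ^ 2 - 2 * c * f z + c ^ 2 := fun c z => by ring
  simp_rw [hsq, Finset.sum_add_distrib, Finset.sum_sub_distrib, ← Finset.mul_sum,
    Finset.sum_const, Finset.card_range, nsmul_eq_mul, empMean]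
  field_simp
  ring

lemma tendsto_corrScale (h : iIndepFun X P) (hident : ∀ n, IdentDistrib (X n) (X 0) P P)
    [IsFiniteMeasure P]
    (hy : ∀ i, Measurable (y i)) (h2 : ∀ i, MemLp (fun ω => y i (X 0 ω)) 2 P)
    (h0 : ∀ i, ∫ ω, y i (X 0 ω) ∂P = 0) (h1 : ∀ i, ∫ ω, y i (X 0 ω) ^ 2 ∂P = 1) :
    ∀ᵐ ω ∂P, Tendsto (fun N => corrScale y K (fun n => X n ω) N) atTop (𝓝 1) := by
  have hsd : ∀ᵐ ω ∂P, ∀ i, Tendsto (fun N => empSd (fun n => X n ω) N (y i)) atTop (𝓝 1) := by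
    refine ae_all_iff.2 fun i => ?_
    have := tendsto_empSd h hident (hy i) ((h2 i).integrable (by norm_num)) (h2 i).integrable_sq
      (h0 i)
    rwa [h1, Real.sqrt_one] at this
  filter_upwards [hsd] with ω hω
  refine tendsto_pi_nhds.2 fun p => ?_
  have hN : Tendsto (fun N : ℕ => (N : ℝ) / (N - (p.2.2 + 1 : ℕ))) atTop (𝓝 1) := by
    simpa only [sub_eq_add_neg] using tendsto_natCast_div_add_atTop (-((p.2.2 + 1 : ℕ) : ℝ))
  have := hN.div ((hω p.1).mul (hω p.2.1)) (by norm_num)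
  rw [mul_one, div_one] at this
  exact this

lemma integral_add_add_half_add_half {F G H J : Ω → ℝ} (hF : Integrable F P)
    (hG : Integrable G P) (hH : Integrable H P) (hJ : Integrable J P) :
    Integrable (fun ω => F ω + G ω + 1 / 2 * H ω + 1 / 2 * J ω) P ∧
      ∫ ω, (F ω + G ω + 1 / 2 * H ω + 1 / 2 * J ω) ∂P =
        ∫ ω, F ω ∂P + ∫ ω, G ω ∂P + 1 / 2 * ∫ ω, H ω ∂P + 1 / 2 * ∫ ω, J ω ∂P := by
  have h1 : Integrable (fun ω => F ω + G ω) P := hF.add hG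
  have h2 : Integrable (fun ω => F ω + G ω + 1 / 2 * H ω) P := h1.add (hH.const_mul _)
  refine ⟨h2.add (hJ.const_mul _), ?_⟩
  rw [integral_add h2 (hJ.const_mul _), integral_add h1 (hH.const_mul _), integral_add hF hG,
    integral_const_mul, integral_const_mul]

variable [IsProbabilityMeasure P]

/-- The constant: at most K tail terms contribute expectation 1 each, and the squared sums, divided
by N, contribute 2 + n/N ≤ 3. -/
lemma integral_abs_centeredLagVector_sub_le (hX : ∀ n, Measurable (X n)) (h : iIndepFun X P)
    (hident : ∀ n, IdentDistrib (X n) (X 0) P P) (hy : ∀ i, Measurable (y i))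
    (h2 : ∀ i, MemLp (fun ω => y i (X 0 ω)) 2 P) (h0 : ∀ i, ∫ ω, y i (X 0 ω) ∂P = 0)
    (horth : ∀ i j, ∫ ω, y i (X 0 ω) * y j (X 0 ω) ∂P = if i = j then 1 else 0) {N : ℕ}
    (hN : N ≠ 0) (p : Fin m × Fin m × Fin K) :
    Integrable (fun ω => |centeredLagVector y K (fun n => X n ω) N p -
        lagVector y K (fun n => X n ω) N p|) P ∧
      ∫ ω, |centeredLagVector y K (fun n => X n ω) N p -
        lagVector y K (fun n => X n ω) N p| ∂P ≤ (√N)⁻¹ * (K + 3) := by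
  obtain ⟨i, j, k⟩ := p
  have hN0 : (0 : ℝ) < N := by positivity
  have hy2 : ∀ i n, MemLp (fun ω => y i (X n ω)) 2 P := fun i n =>
    ((hident n).comp (hy i)).memLp_iff.2 (h2 i)
  have hyv : ∀ i n, ∫ ω, y i (X n ω) ^ 2 ∂P = 1 := by
    intro i n
    refine ((hident n).comp ((hy i).pow_const 2)).integral_eq.trans ?_
    simpa [sq] using horth i i
  have hyo : ∀ i s t, s ≠ t → ∫ ω, y i (X s ω) * y i (X t ω) ∂P = 0 := by
    intro i s t hst
    have h3 := ((h.indepFun hst).comp (hy i) (hy i)).integral_fun_mul_eq_mul_integral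
      ((hy i).comp (hX s)).aestronglyMeasurable ((hy i).comp (hX t)).aestronglyMeasurable
    have h4 : ∫ ω, y i (X s ω) ∂P = 0 := ((hident s).comp (hy i)).integral_eq.trans (h0 i)
    simpa only [Function.comp_def, h4, zero_mul] using h3
  have hsum : ∀ i l n, MemLp (fun ω => ∑ t ∈ Finset.range n, y i (X (t + l) ω)) 2 P := fun i l n =>
    memLp_finsetSum _ fun t _ => hy2 i _
  have hsq : ∀ i l n, ∫ ω, (∑ t ∈ Finset.range n, y i (X (t + l) ω)) ^ 2 ∂P = n := by
    intro i l n
    simpa using integral_sq_sum_of_orthogonal (Z := fun t ω => y i (X (t + l) ω))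
      (fun t => hy2 i _) (fun t => hyv i _) (fun s t hst => hyo i _ _ (by omega)) (Finset.range n)
  have hL2 := memLp_lagProd (K := K) hX h hident hy h2 (i, j, k)
  have hL1 : ∀ t, ∫ ω, lagProd y (i, j, k) (fun n => X n ω) t ^ 2 ∂P = 1 := by
    intro t
    simpa [sq] using integral_lagProd_mul_lagProd hX h hident hy h0 horth (i, j, k) (i, j, k) t t
  set n := N - ((k : ℕ) + 1) with hn
  let D : Ω → ℝ := fun ω =>
    1 / 2 * ∑ t ∈ Finset.range N \ Finset.range n, (lagProd y (i, j, k) (fun n => X n ω) t ^ 2 + 1) +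
      1 / N * ((∑ t ∈ Finset.range N, y i (X (t + 0) ω)) ^ 2 +
        (∑ t ∈ Finset.range N, y j (X (t + 0) ω)) ^ 2 +
        1 / 2 * (∑ t ∈ Finset.range n, y i (X (t + 0) ω)) ^ 2 +
        1 / 2 * (∑ t ∈ Finset.range n, y j (X (t + (k + 1)) ω)) ^ 2)
  have hD1 : ∀ t ∈ Finset.range N \ Finset.range n,
      Integrable (fun ω => lagProd y (i, j, k) (fun n => X n ω) t ^ 2 + 1) P := fun t _ =>
    (hL2 t).integrable_sq.add (integrable_const _)
  have hI := fun i l n => (hsum i l n).integrable_sq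
  obtain ⟨hQ, hQval⟩ := integral_add_add_half_add_half (hI i 0 N) (hI j 0 N) (hI i 0 n)
    (hI j (k + 1) n)
  have hDint : Integrable D P := ((integrable_finsetSum _ hD1).const_mul _).add (hQ.const_mul _)
  have hDval : ∫ ω, D ω ∂P ≤ K + 3 := by
    have hDeq : ∫ ω, D ω ∂P = 1 / 2 * ∑ t ∈ Finset.range N \ Finset.range n, (1 + 1) +
        1 / N * ((N : ℝ) + N + 1 / 2 * n + 1 / 2 * n) := by
      simp only [D]
      rw [integral_add ((integrable_finsetSum _ hD1).const_mul _) (hQ.const_mul _),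
        integral_const_mul, integral_const_mul, integral_finsetSum _ hD1, hQval, hsq, hsq, hsq, hsq]
      congr 2
      refine Finset.sum_congr rfl fun t _ => ?_
      rw [integral_add (hL2 t).integrable_sq (integrable_const _), hL1]
      simp
    have hcard : ((Finset.range N \ Finset.range n).card : ℝ) ≤ K := by
      rw [Finset.card_sdiff_of_subset (Finset.range_subset_range.2 (by omega)), Finset.card_range,
        Finset.card_range]
      -- With truncated subtraction this also covers N < k + 1, where n = 0 and N itself is at most
      -- K.
      exact_mod_cast (by omega : N - n ≤ K)
    have hnN : (n : ℝ) / N ≤ 1 := (div_le_one hN0).2 (by exact_mod_cast Nat.sub_le _ _)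
    rw [hDeq, Finset.sum_const, nsmul_eq_mul]
    have : 1 / (N : ℝ) * ((N : ℝ) + N + 1 / 2 * n + 1 / 2 * n) = 2 + n / N := by
      field_simp
      ring
    rw [this]
    linarith
  have hbound : ∀ ω, |centeredLagVector y K (fun n => X n ω) N (i, j, k) -
      lagVector y K (fun n => X n ω) N (i, j, k)| ≤ (√N)⁻¹ * D ω := by
    intro ω
    simp only [centeredLagVector, lagVector]
    rw [← mul_sub, abs_mul, abs_of_nonneg (by positivity : (0 : ℝ) ≤ (√N)⁻¹)]
    gcongr
    exact abs_sum_sub_mul_sub_sub_sum_le (Nat.sub_le _ _) hN (fun t => y i (X t ω))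
      (fun t => y j (X (t + (k + 1)) ω)) (fun t => lagProd y (i, j, k) (fun n => X n ω) t)
      (fun t => rfl) _ _
  have hmeas : Measurable fun ω => |centeredLagVector y K (fun n => X n ω) N (i, j, k) -
      lagVector y K (fun n => X n ω) N (i, j, k)| := by
    have h3 := measurable_centeredLagVector (K := K) hX hy N
    have h4 := measurable_lagVector (K := K) hX hy N
    have h5 : Measurable fun z : EuclideanSpace ℝ (Fin m × Fin m × Fin K) => z (i, j, k) := by
      fun_prop
    exact ((h5.comp h3).sub (h5.comp h4)).abs
  have hint : Integrable (fun ω => |centeredLagVector y K (fun n => X n ω) N (i, j, k) -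
      lagVector y K (fun n => X n ω) N (i, j, k)|) P :=
    (hDint.const_mul (√N)⁻¹).mono' hmeas.aestronglyMeasurable (ae_of_all _ fun ω => by
      rw [Real.norm_eq_abs, abs_abs]
      exact hbound ω)
  refine ⟨hint, (integral_mono hint (hDint.const_mul (√N)⁻¹) hbound).trans ?_⟩
  rw [integral_const_mul]
  gcongr

/-- The Euclidean norm is at most the ℓ¹ norm, so the coordinatewise L¹ bounds add up and Markov's
inequality applies. -/
lemma tendstoInMeasure_centeredLagVector_sub (hX : ∀ n, Measurable (X n)) (h : iIndepFun X P)
    (hident : ∀ n, IdentDistrib (X n) (X 0) P P) (hy : ∀ i, Measurable (y i))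
    (h2 : ∀ i, MemLp (fun ω => y i (X 0 ω)) 2 P) (h0 : ∀ i, ∫ ω, y i (X 0 ω) ∂P = 0)
    (horth : ∀ i j, ∫ ω, y i (X 0 ω) * y j (X 0 ω) ∂P = if i = j then 1 else 0) :
    TendstoInMeasure P ((fun (N : ℕ) ω => centeredLagVector y K (fun n => X n ω) N) -
      fun (N : ℕ) ω => lagVector y K (fun n => X n ω) N) atTop 0 := by
  rw [tendstoInMeasure_iff_measureReal_norm]
  intro ε hε
  simp only [Pi.sub_apply, Pi.zero_apply, sub_zero]
  have hnorm : ∀ z : EuclideanSpace ℝ (Fin m × Fin m × Fin K), ‖z‖ ≤ ∑ p, |z p| := by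
    intro z
    rw [EuclideanSpace.norm_eq]
    refine Real.sqrt_le_iff.2 ⟨Finset.sum_nonneg fun _ _ => abs_nonneg _, ?_⟩
    exact Finset.sum_sq_le_sq_sum_of_nonneg fun _ _ => abs_nonneg _
  set C : ℝ := Fintype.card (Fin m × Fin m × Fin K) * (K + 3) with hC
  have hlim : Tendsto (fun N : ℕ => (√N)⁻¹ * (C / ε)) atTop (𝓝 0) := by
    rw [← zero_mul (C / ε)]
    exact (tendsto_inv_atTop_zero.comp
      (Real.tendsto_sqrt_atTop.comp tendsto_natCast_atTop_atTop)).mul_const _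
  refine squeeze_zero' (Eventually.of_forall fun _ => measureReal_nonneg) ?_ hlim
  filter_upwards [eventually_ne_atTop 0] with N hN
  have hkey := integral_abs_centeredLagVector_sub_le (K := K) hX h hident hy h2 h0 horth hN
  have hint := integrable_finsetSum Finset.univ fun p _ => (hkey p).1
  have hle : ∫ ω, ∑ p, |centeredLagVector y K (fun n => X n ω) N p -
      lagVector y K (fun n => X n ω) N p| ∂P ≤ (√N)⁻¹ * C := by
    rw [integral_finsetSum _ fun p _ => (hkey p).1]
    refine (Finset.sum_le_sum fun p _ => (hkey p).2).trans_eq ?_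
    rw [Finset.sum_const, Finset.card_univ, nsmul_eq_mul, hC]
    ring
  have hmarkov := mul_meas_ge_le_integral_of_nonneg
    (ae_of_all P fun ω => Finset.sum_nonneg fun p _ => abs_nonneg (centeredLagVector y K
      (fun n => X n ω) N p - lagVector y K (fun n => X n ω) N p)) hint ε
  calc P.real {ω | ε ≤ ‖centeredLagVector y K (fun n => X n ω) N -
          lagVector y K (fun n => X n ω) N‖}
      ≤ P.real {ω | ε ≤ ∑ p, |centeredLagVector y K (fun n => X n ω) N p -
          lagVector y K (fun n => X n ω) N p|} := by
        refine measureReal_mono fun ω hω => ?_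
        exact le_trans hω ((hnorm _).trans_eq (by simp))
    _ ≤ (√N)⁻¹ * C / ε := by
        rw [le_div_iff₀ hε, mul_comm]
        exact hmarkov.trans hle
    _ = _ := by ring

end Remainders

/-! ### The limit for standardized functions -/

section Standardized

variable {Ω : Type*} [MeasurableSpace Ω] {P : Measure Ω} [IsProbabilityMeasure P] {X : ℕ → Ω → ℝ}
  {m K : ℕ} {y : Fin m → ℝ → ℝ}

/-- Slutsky's theorem is used twice: for the additive error, which tends to 0 in probability, and
for the scale factors, which tend to 1. -/
theorem tendstoInDistribution_boxPierce_stdGaussian (hX : ∀ n, Measurable (X n))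
    (h : iIndepFun X P) (hident : ∀ n, IdentDistrib (X n) (X 0) P P) (hy : ∀ i, Measurable (y i))
    (h2 : ∀ i, MemLp (fun ω => y i (X 0 ω)) 2 P) (h0 : ∀ i, ∫ ω, y i (X 0 ω) ∂P = 0)
    (horth : ∀ i j, ∫ ω, y i (X 0 ω) * y j (X 0 ω) ∂P = if i = j then 1 else 0) :
    TendstoInDistribution (fun (N : ℕ) ω => boxPierce y K (fun n => X n ω) N) atTop
      (fun z : EuclideanSpace ℝ (Fin m × Fin m × Fin K) => ∑ p, z p ^ 2) (fun _ => P)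
      (stdGaussian _) := by
  have hV := tendstoInDistribution_of_tendstoInMeasure_sub _ _
    (tendstoInDistribution_lagVector (K := K) hX h hident hy h2 h0 horth)
    (tendstoInMeasure_centeredLagVector_sub hX h hident hy h2 h0 horth)
    fun N => (measurable_centeredLagVector hX hy N).aemeasurable
  have hscale : TendstoInMeasure P (fun (N : ℕ) ω => corrScale y K (fun n => X n ω) N) atTop
      fun _ => 1 :=
    tendstoInMeasure_of_tendsto_ae (fun N => (measurable_corrScale hX hy N).aestronglyMeasurable)
      (tendsto_corrScale h hident hy h2 h0 fun i => by simpa [sq] using horth i i)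
  have := hV.continuous_comp_prodMk_of_tendstoInMeasure_const
    (g := fun q : EuclideanSpace ℝ (Fin m × Fin m × Fin K) × (Fin m × Fin m × Fin K → ℝ) =>
      ∑ p, (q.1 p * q.2 p) ^ 2) (by fun_prop) hscale
    fun N => (measurable_corrScale hX hy N).aemeasurable
  simp_rw [← boxPierce_eq_sum_sq] at this
  simpa using this

/-- The sum of the squares of the coordinates of a standard Gaussian vector has a chi-squared
law. -/
lemma map_sum_sq_stdGaussian {ι : Type*} [Fintype ι] {n : ℕ} (e : Fin n ≃ ι) :
    (stdGaussian (EuclideanSpace ℝ ι)).map (fun z => ∑ p, z p ^ 2) = chiSquared n := by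
  rw [← map_pi_eq_stdGaussian, Measure.map_map (by fun_prop) (by fun_prop), chiSquared,
    ← (measurePreserving_piCongrLeft (fun _ : ι => gaussianReal 0 1) e).map_eq,
    Measure.map_map (by fun_prop) (by fun_prop)]
  congr 1
  ext z
  simp [MeasurableEquiv.coe_piCongrLeft, ← e.sum_comp, Equiv.piCongrLeft_apply_apply]

end Standardized

end IIDTest

theorem corollary6 {Ω : Type*} [MeasurableSpace Ω] (P : Measure Ω) [IsProbabilityMeasure P]
    (X : ℕ → Ω → ℝ) (hX : ∀ n, Measurable (X n))
    (hindep : iIndepFun X P) (hident : ∀ n, IdentDistrib (X n) (X 0) P P)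
    (m K : ℕ) (f : Fin m → ℝ → ℝ) (hf : ∀ i, Measurable (f i))
    (hmoment : ∀ i, Integrable (fun ω => f i (X 0 ω) ^ 4) P)
    (hvar : ∀ i, variance (fun ω => f i (X 0 ω)) P ≠ 0)
    (huncorr : ∀ i j, i ≠ j →
      covariance (fun ω => f i (X 0 ω)) (fun ω => f j (X 0 ω)) P = 0) :
    (∀ (N : ℕ) (ω : Ω), IIDTest.boxPierce f K (fun n => X n ω) N =
      (N : ℝ) * ∑ i : Fin m, ∑ j : Fin m, ∑ k ∈ Finset.Icc 1 K,
        IIDTest.empCrossCorr (fun n => X n ω) N k (f i) (f j) ^ 2) ∧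
    TendstoInDistribution (fun (N : ℕ) (ω : Ω) => IIDTest.boxPierce f K (fun n => X n ω) N)
      atTop (id : ℝ → ℝ) (fun _ => P) (IIDTest.chiSquared (m ^ 2 * K)) := by
  refine ⟨fun N ω => IIDTest.boxPierce_eq_sum f K _ N, ?_⟩
  have hmeas : ∀ i, Measurable fun ω => f i (X 0 ω) := fun i => (hf i).comp (hX 0)
  -- The variance of a function outside L² is 0 by convention, so a nonzero variance gives square
  -- integrability.
  have hL2 : ∀ i, MemLp (fun ω => f i (X 0 ω)) 2 P := fun i =>
    memLp_two_of_variance_ne_zero (hmeas i).aestronglyMeasurable (hvar i)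
  set μ : Fin m → ℝ := fun i => ∫ ω, f i (X 0 ω) ∂P with hμ
  set σ : Fin m → ℝ := fun i => √(variance (fun ω => f i (X 0 ω)) P) with hσ
  have hσ0 : ∀ i, 0 < σ i := fun i =>
    Real.sqrt_pos.2 ((variance_nonneg _ _).lt_of_ne (hvar i).symm)
  let y : Fin m → ℝ → ℝ := fun i z => (f i z - μ i) / σ i
  have hlim := IIDTest.tendstoInDistribution_boxPierce_stdGaussian (K := K) (y := y) hX hindep
    hident (fun i => ((hf i).sub_const _).div_const _)
    (fun i => by
      simpa only [y, div_eq_inv_mul, Pi.sub_apply] using ((hL2 i).sub (memLp_const _)).const_mul (σ i)⁻¹)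
    (fun i => by
      simp only [y]
      rw [integral_div, integral_sub ((hL2 i).integrable (by norm_num)) (integrable_const _)]
      simp [hμ])
    (fun i j => by
      have hcov : ∫ ω, y i (X 0 ω) * y j (X 0 ω) ∂P =
          covariance (fun ω => f i (X 0 ω)) (fun ω => f j (X 0 ω)) P / (σ i * σ j) := by
        simp only [y, div_mul_div_comm]
        rw [integral_div]
        rfl
      rw [hcov]
      split_ifs with hij
      · subst hij
        rw [covariance_self (hmeas i).aemeasurable, Real.mul_self_sqrt (variance_nonneg _ _),
          div_self (hvar i)]
      · rw [huncorr i j hij, zero_div])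
  have hstat : ∀ x N, IIDTest.boxPierce y K x N = IIDTest.boxPierce f K x N := fun x N => by
    simp_rw [IIDTest.boxPierce_eq_sum, y,
      IIDTest.empCrossCorr_sub_div x N _ _ _ _ _ (hσ0 _) (hσ0 _)]
  simp_rw [hstat] at hlim
  -- Any bijection serves, since the Gaussian coordinates are i.i.d. and the sum of squares is
  -- symmetric.
  have e : Fin (m ^ 2 * K) ≃ Fin m × Fin m × Fin K :=
    Fintype.equivOfCardEq (by simp [sq, mul_assoc])
  refine ⟨hlim.forall_aemeasurable, by fun_prop, ?_⟩
  convert hlim.tendsto using 2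
  exact congrArg nhds
    (Subtype.ext (Measure.map_id.trans (IIDTest.map_sum_sq_stdGaussian e).symm))
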